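/- Let $p,q\ge 1$ be integers, $n=p+q$, and $X=\{1,\dots,n\}\cup\{-1,\dots,-n\}$. Let $D_n$ be the group of even permutations $\tau$ of $X$ such that $\tau(-i)=-\tau(i)$ for all $i\in X$, and let $\gamma=(1,\dots,p,-1,\dots,-p)(p+1,\dots,n,-(p+1),\dots,-n)\in D_n$. For $\tau\in D_n$ let $\ell_D(\tau)$ be the smallest $k$ such that $\tau$ is a product of $k$ permutations of the form $(i,j)(-i,-j)$ or $(i,-j)(-i,j)$ with $1\le i<j\le n$, and partially order $D_n$ by $$\sigma\le\tau\iff \ell_D(\tau)=\ell_D(\sigma)+\ell_D(\sigma^{-1}\tau).$$ Write $\#(\tau)$ for the number of orbits of a permutation $\tau$ of $X$ (fixed points included) and $\#(\tau,\gamma)$ for the number of orbits on $X$ of the group generated by $\tau$ and $\gamma$, and let $$S^D_{nc}(p,q)=\{\tau\in D_n : \#(\tau)+\#(\tau^{-1}\gamma)+\#(\gamma)=|X|+2\,\#(\tau,\gamma)\},$$ with the partial order induced from $D_n$. For $\tau\in D_n$ let $\widetilde\Omega(\tau)$ be the partition of $X$ obtained from the partition into orbits of $\tau$ by merging all the orbits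 $A$ with $A=-A$ (if any) into a single block. Let $NC^D(p,q)=\{\widetilde\Omega(\tau):\tau\in S^D_{nc}(p,q)\}$, ordered by reverse refinement ($\pi\le\rho$ if and only if every block of $\rho$ is a union of blocks of $\pi$). Then the map $\tau\mapsto\widetilde\Omega(\tau)$ is a poset isomorphism from $S^D_{nc}(p,q)$ onto $NC^D(p,q)$. -/

import Mathlib

namespace AnnularNC

/-- The set `{1, …, n} ∪ {-1, …, -n}`, as a finite set of integers. -/
abbrev SignedSet (n : ℕ) : Type := {x : ℤ // x ∈ (Finset.Icc (-(n : ℤ)) (n : ℤ)).erase 0}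

instance (n : ℕ) : Neg (SignedSet n) :=
  ⟨fun x => ⟨-(x : ℤ), by have h := x.2; simp only [Finset.mem_erase, Finset.mem_Icc] at h ⊢; omega⟩⟩

/-- The hyperoctahedral group `B_n`: the permutations `τ` with `τ(-i) = -τ(i)`. -/
def typeB (n : ℕ) : Subgroup (Equiv.Perm (SignedSet n)) where
  carrier := {τ | ∀ i, τ (-i) = -τ i}
  one_mem' := fun _ => rfl
  mul_mem' := by
    intro a b ha hb i
    simp only [Set.mem_ofPred_eq] at ha hb
    simp only [Equiv.Perm.mul_apply, ha, hb]
  inv_mem' := by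
    intro a ha i
    simp only [Set.mem_ofPred_eq] at ha
    rw [Equiv.Perm.inv_eq_iff_eq, ha]
    exact congrArg _ (Equiv.apply_symm_apply a i).symm

/-- The Weyl group `D_n`: the even permutations in `B_n`. -/
noncomputable def typeD (n : ℕ) : Subgroup (Equiv.Perm (SignedSet n)) :=
  typeB n ⊓ alternatingGroup (SignedSet n)

/-- The values of `γ = (1, …, p, -1, …, -p)(p+1, …, p+q, -(p+1), …, -(p+q))`. -/
def gammaFun (p q : ℕ) (x : ℤ) : ℤ :=
  if x = p then -1
  else if x = -p then 1
  else if x = p + q then -(p + 1)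
  else if x = -(p + q) then p + 1
  else if 0 < x then x + 1 else x - 1

/-- The values of `γ⁻¹`. -/
def gammaInvFun (p q : ℕ) (x : ℤ) : ℤ :=
  if x = p + 1 then -(p + q)
  else if x = -(p + 1) then p + q
  else if x = 1 then -p
  else if x = -1 then p
  else if 0 < x then x - 1 else x + 1

theorem gammaFun_mem {p q : ℕ} {x : ℤ}
    (h : x ∈ (Finset.Icc (-((p + q : ℕ) : ℤ)) ((p + q : ℕ) : ℤ)).erase 0) :
    gammaFun p q x ∈ (Finset.Icc (-((p + q : ℕ) : ℤ)) ((p + q : ℕ) : ℤ)).erase 0 := by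
  simp only [Finset.mem_erase, Finset.mem_Icc] at h ⊢
  unfold gammaFun
  omega

theorem gammaInvFun_mem {p q : ℕ} {x : ℤ}
    (h : x ∈ (Finset.Icc (-((p + q : ℕ) : ℤ)) ((p + q : ℕ) : ℤ)).erase 0) :
    gammaInvFun p q x ∈ (Finset.Icc (-((p + q : ℕ) : ℤ)) ((p + q : ℕ) : ℤ)).erase 0 := by
  simp only [Finset.mem_erase, Finset.mem_Icc] at h ⊢
  unfold gammaInvFun
  omega

theorem gammaInvFun_gammaFun {p q : ℕ} {x : ℤ}
    (h : x ∈ (Finset.Icc (-((p + q : ℕ) : ℤ)) ((p + q : ℕ) : ℤ)).erase 0) :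
    gammaInvFun p q (gammaFun p q x) = x := by
  simp only [Finset.mem_erase, Finset.mem_Icc] at h
  obtain ⟨y, hy⟩ : ∃ y, y = gammaFun p q x := ⟨_, rfl⟩
  rw [← hy]
  unfold gammaFun at hy
  unfold gammaInvFun
  omega

theorem gammaFun_gammaInvFun {p q : ℕ} {x : ℤ}
    (h : x ∈ (Finset.Icc (-((p + q : ℕ) : ℤ)) ((p + q : ℕ) : ℤ)).erase 0) :
    gammaFun p q (gammaInvFun p q x) = x := by
  simp only [Finset.mem_erase, Finset.mem_Icc] at h
  obtain ⟨y, hy⟩ : ∃ y, y = gammaInvFun p q x := ⟨_, rfl⟩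
  rw [← hy]
  unfold gammaInvFun at hy
  unfold gammaFun
  omega

/-- The permutation `γ = (1, …, p, -1, …, -p)(p+1, …, p+q, -(p+1), …, -(p+q))`. -/
def gamma (p q : ℕ) : Equiv.Perm (SignedSet (p + q)) where
  toFun x := ⟨gammaFun p q x, gammaFun_mem x.2⟩
  invFun x := ⟨gammaInvFun p q x, gammaInvFun_mem x.2⟩
  left_inv x := Subtype.ext (gammaInvFun_gammaFun x.2)
  right_inv x := Subtype.ext (gammaFun_gammaInvFun x.2)

/-- The number of orbits of a group of permutations of `X`. -/
noncomputable def numOrbits {X : Type*} (G : Subgroup (Equiv.Perm X)) : ℕ :=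
  Nat.card (MulAction.orbitRel.Quotient G X)

/-- The set of non-crossing (genus zero) permutations of a finite set `X` with respect to `γ`:
those `τ` with `#(τ) + #(τ⁻¹γ) + #(γ) = |X| + 2 #(τ, γ)`. -/
def Snc {X : Type*} (γ : Equiv.Perm X) : Set (Equiv.Perm X) :=
  {τ | numOrbits (Subgroup.zpowers τ) + numOrbits (Subgroup.zpowers (τ⁻¹ * γ))
      + numOrbits (Subgroup.zpowers γ)
    = Nat.card X + 2 * numOrbits (Subgroup.closure {τ, γ})}

/-- The annular non-crossing permutations of type D. -/
def SncD (p q : ℕ) : Set (Equiv.Perm (SignedSet (p + q))) :=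
  Snc (gamma p q) ∩ (typeD (p + q) : Set (Equiv.Perm (SignedSet (p + q))))

/-- The generators `(i,j)(-i,-j)` and `(i,-j)(-i,j)`, `1 ≤ i < j ≤ n`, of `D_n`. -/
def generatorsD (n : ℕ) : Set (Equiv.Perm (SignedSet n)) :=
  {g | ∃ i j : SignedSet n, 0 < (i : ℤ) ∧ (i : ℤ) < (j : ℤ) ∧
    (g = Equiv.swap i j * Equiv.swap (-i) (-j) ∨ g = Equiv.swap i (-j) * Equiv.swap (-i) j)}

/-- The length `ℓ_D(τ)`: the least `k` such that `τ` is a product of `k` generators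
(meaningful for `τ ∈ D_n`, since the generators generate `D_n`). -/
noncomputable def lengthD {n : ℕ} (τ : Equiv.Perm (SignedSet n)) : ℕ :=
  sInf {k | ∃ l : List (Equiv.Perm (SignedSet n)),
    l.length = k ∧ (∀ g ∈ l, g ∈ generatorsD n) ∧ l.prod = τ}

/-- The partial order on `D_n`: `σ ≤ τ` iff `ℓ_D(τ) = ℓ_D(σ) + ℓ_D(σ⁻¹τ)`. -/
instance (n : ℕ) : LE (typeD n) :=
  ⟨fun σ τ => lengthD (τ : Equiv.Perm (SignedSet n)) =
    lengthD (σ : Equiv.Perm (SignedSet n)) + lengthD ((σ⁻¹ * τ : typeD n) : Equiv.Perm (SignedSet n))⟩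

/-- `SncD p q` carries the order induced from `D_n`. -/
instance (p q : ℕ) : LE (SncD p q) :=
  ⟨fun σ τ => (⟨σ.1, σ.2.2⟩ : typeD (p + q)) ≤ ⟨τ.1, τ.2.2⟩⟩

/-- `x` lies in a zero-block of `τ`: the orbit `A` of `x` under `τ` satisfies `A = -A`. -/
def InZeroBlock {n : ℕ} (τ : Equiv.Perm (SignedSet n)) (x : SignedSet n) : Prop :=
  ∀ y, τ.SameCycle x y ↔ τ.SameCycle x (-y)

theorem InZeroBlock.of_sameCycle {n : ℕ} {τ : Equiv.Perm (SignedSet n)} {x y : SignedSet n}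
    (hx : InZeroBlock τ x) (h : τ.SameCycle x y) : InZeroBlock τ y := fun z =>
  ⟨fun hz => h.symm.trans ((hx z).1 (h.trans hz)), fun hz => h.symm.trans ((hx z).2 (h.trans hz))⟩

/-- The partition obtained from the orbit partition of `τ` by merging all the zero-blocks into one
block. Partitions of a set are encoded by equivalence relations; the order `r ≤ s` on `Setoid`
(`r x y → s x y`) is reverse refinement: every block of `s` is a union of blocks of `r`. -/
def omegaTilde {n : ℕ} (τ : Equiv.Perm (SignedSet n)) : Setoid (SignedSet n) where
  r x y := τ.SameCycle x y ∨ (InZeroBlock τ x ∧ InZeroBlock τ y)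
  iseqv :=
    { refl := fun x => Or.inl (Equiv.Perm.SameCycle.refl τ x)
      symm := fun h => h.imp (fun h => h.symm) (fun h => h.symm)
      trans := by
        rintro x y z (h | ⟨hx, hy⟩) (h' | ⟨hy', hz⟩)
        · exact Or.inl (h.trans h')
        · exact Or.inr ⟨hy'.of_sameCycle h.symm, hz⟩
        · exact Or.inr ⟨hx, hy.of_sameCycle h'⟩
        · exact Or.inr ⟨hx, hz⟩ }

/-- The set `NC^D(p,q)`, ordered by reverse refinement (as a subset of all partitions). -/
def NCD (p q : ℕ) : Set (Setoid (SignedSet (p + q))) :=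
  {π | ∃ τ ∈ SncD p q, omegaTilde τ = π}

end AnnularNC

/-! Let the signed permutations act on the odd functions on X, the reflection representation, and
write Fix(τ) for the odd functions fixed by τ. Three facts translate the statement into linear
algebra.

Length: for τ in D_n, `lengthD` is the codimension of Fix(τ) (`lengthD_add_finrank_oddFixed`).
Blocks: those of `omegaTilde τ` are the joint level sets of Fix(τ), so reverse refinement of
partitions is reverse inclusion of fixed spaces (`omegaTilde_le_iff`). Genus: orbit numbers are
dimensions of fixed spaces, which split into even and odd parts. The even part obeys a genus
inequality, so the equality defining `Snc` forces codim Fix(τ) + codim Fix(τ⁻¹γ) ≤ dim of the odd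
functions (`finrank_oddFun_le_of_mem_Snc`). Since Fix(γ) = 0, this says that τ lies below γ in the
codimension order.

It remains to see that isometries below a common w without nonzero fixed vectors are ordered, hence
determined, by their fixed spaces (`finrank_fixedIn_inv_mul_le`). No geometry of the annulus is
needed. -/

namespace AnnularNC

open Module

/-! ### Fixed spaces of isometries and the codimension order -/

section Isometries

variable {E : Type*} [NormedAddCommGroup E] [InnerProductSpace ℝ E]
  {G : Type*} [Group G]

/-- The vectors of `W` fixed by `g`. -/
def fixedIn (ρ : G →* (E ≃ₗᵢ[ℝ] E)) (W : Submodule ℝ E) (g : G) : Submodule ℝ E where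
  carrier := {x | x ∈ W ∧ ρ g x = x}
  zero_mem' := ⟨W.zero_mem, map_zero _⟩
  add_mem' := fun hx hy => ⟨W.add_mem hx.1 hy.1, by rw [map_add, hx.2, hy.2]⟩
  smul_mem' := fun c x hx => ⟨W.smul_mem c hx.1, by rw [map_smul, hx.2]⟩

variable {ρ : G →* (E ≃ₗᵢ[ℝ] E)} {W : Submodule ℝ E}

theorem mem_fixedIn {g : G} {x : E} : x ∈ fixedIn ρ W g ↔ x ∈ W ∧ ρ g x = x := Iff.rfl

theorem rho_mul_apply (u v : G) (x : E) : ρ (u * v) x = ρ u (ρ v x) := by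
  rw [map_mul]
  rfl

theorem fixedIn_le (g : G) : fixedIn ρ W g ≤ W := fun _ hx => hx.1

theorem fixedIn_inf_le_mul (u v : G) :
    fixedIn ρ W u ⊓ fixedIn ρ W v ≤ fixedIn ρ W (u * v) := by
  rintro x ⟨hu, hv⟩
  refine ⟨hu.1, ?_⟩
  rw [rho_mul_apply, hv.2, hu.2]

theorem rho_inv_mul_apply_eq_iff (u v : G) (x : E) :
    ρ (u⁻¹ * v) x = x ↔ ρ v x = ρ u x := by
  rw [rho_mul_apply]
  constructor
  · intro h
    have h2 := congrArg (ρ u) h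
    rw [← rho_mul_apply, mul_inv_cancel, map_one] at h2
    exact h2
  · intro h
    rw [h, ← rho_mul_apply, inv_mul_cancel, map_one]
    rfl

theorem inner_rho_sub_eq_zero {g : G} {x y : E} (hy : ρ g y = y) :
    inner ℝ y (ρ g x - x) = 0 := by
  rw [inner_sub_right, sub_eq_zero]
  nth_rewrite 1 [← hy]
  exact (ρ g).inner_map_map y x

variable [FiniteDimensional ℝ E]

theorem finrank_fixedIn_add_le (u v : G) :
    finrank ℝ (fixedIn ρ W u) + finrank ℝ (fixedIn ρ W v)
      ≤ finrank ℝ W + finrank ℝ (fixedIn ρ W (u * v)) := by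
  have h1 := Submodule.finrank_sup_add_finrank_inf_eq (fixedIn ρ W u) (fixedIn ρ W v)
  have h2 := Submodule.finrank_mono (fixedIn_inf_le_mul (ρ := ρ) (W := W) u v)
  have h3 := Submodule.finrank_mono (sup_le (fixedIn_le (ρ := ρ) (W := W) u) (fixedIn_le (ρ := ρ) v))
  omega

/-- Equality in the subadditivity of codimension forces the fixed space of the product to be the
intersection of those of the factors. -/
theorem fixedIn_mul_le_of_finrank_eq {u v : G}
    (h : finrank ℝ W + finrank ℝ (fixedIn ρ W (u * v))
      ≤ finrank ℝ (fixedIn ρ W u) + finrank ℝ (fixedIn ρ W v)) :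
    fixedIn ρ W (u * v) ≤ fixedIn ρ W u := by
  have h1 := Submodule.finrank_sup_add_finrank_inf_eq (fixedIn ρ W u) (fixedIn ρ W v)
  have h3 := Submodule.finrank_mono (sup_le (fixedIn_le (ρ := ρ) (W := W) u) (fixedIn_le (ρ := ρ) v))
  have h4 := Submodule.eq_of_le_of_finrank_le (fixedIn_inf_le_mul (ρ := ρ) (W := W) u v) (by omega)
  rw [← h4]
  exact inf_le_left

/-- The genus inequality for a pair of isometries preserving `W`. -/
theorem finrank_fixedIn_genus_le (u v : G) (hv : ∀ x ∈ W, ρ v x ∈ W) :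
    finrank ℝ (fixedIn ρ W u) + finrank ℝ (fixedIn ρ W v) + finrank ℝ (fixedIn ρ W (u * v))
      ≤ finrank ℝ W + 2 * finrank ℝ (fixedIn ρ W u ⊓ fixedIn ρ W v : Submodule ℝ E) := by
  set A := fixedIn ρ W u
  set B := fixedIn ρ W v
  set C := fixedIn ρ W (u * v)
  have h1 := Submodule.finrank_sup_add_finrank_inf_eq A B
  have h2 := Submodule.finrank_add_inf_finrank_orthogonal
    (sup_le (fixedIn_le (ρ := ρ) (W := W) u) (fixedIn_le (ρ := ρ) v))
  let φ : C →ₗ[ℝ] E := ((ρ v).toLinearEquiv.toLinearMap - LinearMap.id) ∘ₗ C.subtype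
  have hφ (x : C) : φ x = ρ v x - x := rfl
  have hC (x : C) : ρ u (ρ v x) = x := by
    rw [← rho_mul_apply]; exact x.2.2
  have h3 := φ.finrank_range_add_finrank_ker
  -- Displacements of an isometry are orthogonal to its fixed vectors. For `x` in `C`, `ρ v x - x`
  -- is the displacement of `x` under `v` and minus that of `ρ v x` under `u`. Rank-nullity for `φ`
  -- then gives the inequality.
  have hr : LinearMap.range φ ≤ (A ⊔ B)ᗮ ⊓ W := by
    rintro _ ⟨x, rfl⟩
    rw [hφ]
    refine ⟨?_, W.sub_mem (hv _ x.2.1) x.2.1⟩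
    rw [← Submodule.inf_orthogonal]
    refine ⟨fun y hy => ?_, fun y hy => inner_rho_sub_eq_zero hy.2⟩
    have := inner_rho_sub_eq_zero (x := ρ v x) hy.2
    rw [hC, ← neg_sub, inner_neg_right, neg_eq_zero] at this
    exact this
  have hk : finrank ℝ (LinearMap.ker φ) ≤ finrank ℝ (A ⊓ B : Submodule ℝ E) := by
    rw [LinearEquiv.finrank_eq (Submodule.equivMapOfInjective _ C.subtype_injective _)]
    refine Submodule.finrank_mono ?_
    rintro _ ⟨x, hx, rfl⟩
    have hxv : ρ v x = x := sub_eq_zero.1 hx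
    have hxu := hC x
    rw [hxv] at hxu
    exact ⟨⟨x.2.1, hxu⟩, ⟨x.2.1, hxv⟩⟩
  have h4 := Submodule.finrank_mono hr
  have h5 : finrank ℝ (A ⊔ B : Submodule ℝ E) + finrank ℝ ((A ⊔ B)ᗮ ⊓ W : Submodule ℝ E)
    = finrank ℝ W := h2
  omega

/-- Isometries `u` below `w` (for the codimension order) are ordered by their fixed spaces. -/
theorem finrank_fixedIn_inv_mul_le {u v w : G} (hw : ∀ x ∈ W, ρ w x ∈ W)
    (hfix : fixedIn ρ W w = ⊥)
    (hu : finrank ℝ W ≤ finrank ℝ (fixedIn ρ W u) + finrank ℝ (fixedIn ρ W (u⁻¹ * w)))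
    (hv : finrank ℝ W ≤ finrank ℝ (fixedIn ρ W v) + finrank ℝ (fixedIn ρ W (v⁻¹ * w)))
    (huv : fixedIn ρ W v ≤ fixedIn ρ W u) :
    finrank ℝ W + finrank ℝ (fixedIn ρ W v)
      ≤ finrank ℝ (fixedIn ρ W (u⁻¹ * v)) + finrank ℝ (fixedIn ρ W u) := by
  -- Where `g` and `w` agree, `w - 1` equals `g - 1` and so lands in the orthogonal complement of
  -- the fixed space of `g`. Both sides therefore lie in the preimage `N` of the complement for `v`,
  -- and `hv` makes the right side fill `N`.
  have key : fixedIn ρ W (u⁻¹ * w) ≤ fixedIn ρ W (v⁻¹ * w) := by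
    let δ : W →ₗ[ℝ] E := ((ρ w).toLinearEquiv.toLinearMap - LinearMap.id) ∘ₗ W.subtype
    have hδ (x : W) : δ x = ρ w x - x := rfl
    have hδinj : Function.Injective δ := by
      rw [← LinearMap.ker_eq_bot, LinearMap.ker_eq_bot']
      intro x hx
      rw [hδ, sub_eq_zero] at hx
      have : (x : E) ∈ fixedIn ρ W w := ⟨x.2, hx⟩
      rw [hfix, Submodule.mem_bot] at this
      exact Subtype.ext this
    let N : Submodule ℝ E := ((fixedIn ρ W v)ᗮ.comap δ).map W.subtype
    have hsub {g : G} (hg : fixedIn ρ W v ≤ fixedIn ρ W g) : fixedIn ρ W (g⁻¹ * w) ≤ N := by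
      rintro x ⟨hxW, hx⟩
      rw [rho_inv_mul_apply_eq_iff] at hx
      refine ⟨⟨x, hxW⟩, ?_, rfl⟩
      intro y hy
      rw [hδ, hx]
      exact inner_rho_sub_eq_zero (hg hy).2
    have hN : finrank ℝ N + finrank ℝ (fixedIn ρ W v) ≤ finrank ℝ W := by
      have h1 := Submodule.finrank_add_inf_finrank_orthogonal (fixedIn_le (ρ := ρ) (W := W) v)
      have h2 : finrank ℝ N ≤ finrank ℝ ((fixedIn ρ W v)ᗮ ⊓ W : Submodule ℝ E) := by
        have h3 : finrank ℝ N = finrank ℝ ((fixedIn ρ W v)ᗮ.comap δ) :=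
          LinearEquiv.finrank_eq
            (Submodule.equivMapOfInjective _ W.subtype_injective _).symm
        have h4 := LinearEquiv.finrank_eq
            (Submodule.equivMapOfInjective δ hδinj ((fixedIn ρ W v)ᗮ.comap δ))
        rw [h3, h4]
        refine Submodule.finrank_mono ?_
        rintro _ ⟨x, hx, rfl⟩
        exact ⟨hx, W.sub_mem (hw _ x.2) x.2⟩
      omega
    have hNeq := Submodule.eq_of_le_of_finrank_le (hsub le_rfl) (by omega)
    rw [hNeq]
    exact hsub huv
  -- `u` and `v` agree on both summands: on the first both equal `w`, on the second both are the
  -- identity. The sum is direct because `w` fixes no nonzero vector.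
  have hle : fixedIn ρ W (u⁻¹ * w) ⊔ fixedIn ρ W v ≤ fixedIn ρ W (u⁻¹ * v) := by
    refine sup_le (fun x hx => ⟨hx.1, ?_⟩) (fun x hx => ⟨hx.1, ?_⟩)
    · have h1 := (rho_inv_mul_apply_eq_iff u w x).1 hx.2
      have h2 := (rho_inv_mul_apply_eq_iff v w x).1 (key hx).2
      rw [rho_inv_mul_apply_eq_iff, ← h1, ← h2]
    · rw [rho_inv_mul_apply_eq_iff, hx.2, (huv hx).2]
  have hinf : fixedIn ρ W (u⁻¹ * w) ⊓ fixedIn ρ W v = ⊥ := by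
    rw [eq_bot_iff, ← hfix]
    rintro x ⟨hx, hxv⟩
    have h2 := (rho_inv_mul_apply_eq_iff v w x).1 (key hx).2
    exact ⟨hx.1, h2.trans hxv.2⟩
  have h1 := Submodule.finrank_sup_add_finrank_inf_eq (fixedIn ρ W (u⁻¹ * w)) (fixedIn ρ W v)
  rw [hinf, finrank_bot] at h1
  have h2 := Submodule.finrank_mono hle
  omega

end Isometries

/-! ### Orbit counts as dimensions of spaces of invariant functions -/

section PermutationFunctions

variable {X : Type*} [Fintype X]

/-- The permutation representation on functions on `X`. -/
noncomputable def permRep (X : Type*) [Fintype X] :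
    Equiv.Perm X →* (EuclideanSpace ℝ X ≃ₗᵢ[ℝ] EuclideanSpace ℝ X) where
  toFun τ := LinearIsometryEquiv.piLpCongrLeft 2 ℝ ℝ τ
  map_one' := by ext f x; rfl
  map_mul' σ τ := by ext f x; rfl

theorem permRep_apply (τ : Equiv.Perm X) (f : EuclideanSpace ℝ X) (x : X) :
    permRep X τ f x = f (τ⁻¹ x) := rfl

theorem permRep_eq_iff {τ : Equiv.Perm X} {f : EuclideanSpace ℝ X} :
    permRep X τ f = f ↔ ∀ x, f (τ x) = f x := by
  constructor
  · intro h x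
    have := congrArg (fun g : EuclideanSpace ℝ X => g (τ x)) h
    rw [permRep_apply, show τ⁻¹ (τ x) = x from τ.symm_apply_apply x] at this
    exact this.symm
  · intro h
    ext x
    rw [permRep_apply, ← h (τ⁻¹ x), show τ (τ⁻¹ x) = x from τ.apply_symm_apply x]

theorem apply_eq_of_mem_closure {f : EuclideanSpace ℝ X}
    {S : Set (Equiv.Perm X)} (h : ∀ g ∈ S, permRep X g f = f)
    {g : Equiv.Perm X} (hg : g ∈ Subgroup.closure S) (x : X) : f (g x) = f x := by
  revert x
  rw [← permRep_eq_iff]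
  induction hg using Subgroup.closure_induction with
  | mem g hg => exact h g hg
  | one => rw [map_one]; rfl
  | mul a b _ _ ha hb => rw [rho_mul_apply, hb, ha]
  | inv a _ ha =>
    rw [← mul_one a⁻¹, rho_inv_mul_apply_eq_iff, ha, map_one]; rfl

/-- The embedding of the functions on the orbits of `G` into the functions on `X`. -/
noncomputable def orbitPullback (G : Subgroup (Equiv.Perm X)) :
    (MulAction.orbitRel.Quotient G X → ℝ) →ₗ[ℝ] EuclideanSpace ℝ X :=
  (WithLp.linearEquiv 2 ℝ (X → ℝ)).symm.toLinearMap ∘ₗ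
    LinearMap.funLeft ℝ ℝ (Quotient.mk (MulAction.orbitRel G X))

theorem finrank_range_orbitPullback (G : Subgroup (Equiv.Perm X)) :
    finrank ℝ (LinearMap.range (orbitPullback G)) = numOrbits G := by
  classical
  have : Fintype (MulAction.orbitRel.Quotient G X) := Fintype.ofFinite _
  rw [LinearMap.finrank_range_of_inj, finrank_fintype_fun_eq_card, numOrbits,
    Nat.card_eq_fintype_card]
  exact (WithLp.linearEquiv 2 ℝ (X → ℝ)).symm.injective.comp
    (LinearMap.funLeft_injective_of_surjective _ _ _ Quotient.mk_surjective)

omit [Fintype X] in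
theorem mem_range_orbitPullback {G : Subgroup (Equiv.Perm X)} {f : EuclideanSpace ℝ X} :
    f ∈ LinearMap.range (orbitPullback G) ↔ ∀ g ∈ G, ∀ x, f (g x) = f x := by
  constructor
  · rintro ⟨h, rfl⟩ g hg x
    exact congrArg h (Quotient.sound ⟨⟨g, hg⟩, rfl⟩)
  · intro h
    refine ⟨fun o => Quotient.liftOn o f ?_, ?_⟩
    · rintro a b ⟨⟨g, hg⟩, rfl⟩
      exact h g hg b
    · ext x
      rfl

theorem numOrbits_zpowers (τ : Equiv.Perm X) :
    numOrbits (Subgroup.zpowers τ) = finrank ℝ (fixedIn (permRep X) ⊤ τ) := by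
  rw [← finrank_range_orbitPullback]
  suffices h : LinearMap.range (orbitPullback (Subgroup.zpowers τ)) = fixedIn (permRep X) ⊤ τ by
    rw [h]
  ext f
  rw [mem_range_orbitPullback, mem_fixedIn, permRep_eq_iff]
  refine ⟨fun h => ⟨trivial, h τ (Subgroup.mem_zpowers τ)⟩, fun h g hg x => ?_⟩
  refine apply_eq_of_mem_closure (S := {τ}) ?_ (by rwa [← Subgroup.zpowers_eq_closure]) x
  rintro _ rfl
  exact permRep_eq_iff.2 h.2

theorem finrank_fixedIn_inf_le (W : Submodule ℝ (EuclideanSpace ℝ X)) (σ τ : Equiv.Perm X) :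
    finrank ℝ (fixedIn (permRep X) W σ ⊓ fixedIn (permRep X) W τ :
      Submodule ℝ (EuclideanSpace ℝ X)) ≤ numOrbits (Subgroup.closure {σ, τ}) := by
  rw [← finrank_range_orbitPullback]
  refine Submodule.finrank_mono ?_
  rintro f ⟨h1, h2⟩
  rw [mem_range_orbitPullback]
  intro g hg x
  refine apply_eq_of_mem_closure ?_ hg x
  rintro _ (rfl | rfl)
  · exact h1.2
  · exact h2.2

end PermutationFunctions

/-! ### Even and odd functions; the genus condition -/

section SignedFunctions

variable {n : ℕ}

instance : InvolutiveNeg (SignedSet n) where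
  neg_neg x := Subtype.ext (neg_neg (x : ℤ))

theorem SignedSet.neg_ne_self (x : SignedSet n) : -x ≠ x := by
  intro h
  have h1 : -(x : ℤ) = x := congrArg Subtype.val h
  have h2 := x.2
  simp only [Finset.mem_erase] at h2
  omega

/-- The odd functions on the signed set. -/
def oddFun (n : ℕ) : Submodule ℝ (EuclideanSpace ℝ (SignedSet n)) where
  carrier := {f | ∀ x, f (-x) = -f x}
  zero_mem' := fun _ => by simp
  add_mem' := fun hf hg x => by simp only [PiLp.add_apply, hf x, hg x]; ring
  smul_mem' := fun c f hf x => by simp only [PiLp.smul_apply, hf x, smul_eq_mul]; ring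

/-- The even functions on the signed set. -/
def evenFun (n : ℕ) : Submodule ℝ (EuclideanSpace ℝ (SignedSet n)) where
  carrier := {f | ∀ x, f (-x) = f x}
  zero_mem' := fun _ => by simp
  add_mem' := fun hf hg x => by simp only [PiLp.add_apply, hf x, hg x]
  smul_mem' := fun c f hf x => by simp only [PiLp.smul_apply, hf x]

/-- The odd functions fixed by `τ`. -/
noncomputable abbrev oddFixed (τ : Equiv.Perm (SignedSet n)) :
    Submodule ℝ (EuclideanSpace ℝ (SignedSet n)) :=
  fixedIn (permRep _) (oddFun n) τ

theorem mem_oddFixed {τ : Equiv.Perm (SignedSet n)} {f : EuclideanSpace ℝ (SignedSet n)} :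
    f ∈ oddFixed τ ↔ (∀ x, f (-x) = -f x) ∧ ∀ x, f (τ x) = f x := by
  rw [mem_fixedIn, permRep_eq_iff]
  rfl

theorem permRep_mem_oddFun {τ : Equiv.Perm (SignedSet n)} (hτ : τ ∈ typeB n)
    (f : EuclideanSpace ℝ (SignedSet n)) (hf : f ∈ oddFun n) : permRep _ τ f ∈ oddFun n := by
  intro x
  rw [permRep_apply, permRep_apply, (typeB n).inv_mem hτ, hf]

theorem permRep_mem_evenFun {τ : Equiv.Perm (SignedSet n)} (hτ : τ ∈ typeB n)
    (f : EuclideanSpace ℝ (SignedSet n)) (hf : f ∈ evenFun n) : permRep _ τ f ∈ evenFun n := by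
  intro x
  rw [permRep_apply, permRep_apply, (typeB n).inv_mem hτ, hf]

theorem finrank_evenFun_add_finrank_oddFun_le :
    finrank ℝ (evenFun n) + finrank ℝ (oddFun n) ≤ Nat.card (SignedSet n) := by
  have h1 := Submodule.finrank_sup_add_finrank_inf_eq (evenFun n) (oddFun n)
  have h2 : evenFun n ⊓ oddFun n = ⊥ := by
    rw [eq_bot_iff]
    rintro f ⟨he, ho⟩
    rw [Submodule.mem_bot]
    ext x
    have h3 := he x
    have h4 := ho x
    simp only [PiLp.zero_apply]
    linarith
  rw [h2, finrank_bot] at h1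
  have h3 := Submodule.finrank_le (evenFun n ⊔ oddFun n)
  rw [finrank_euclideanSpace, ← Nat.card_eq_fintype_card] at h3
  omega

theorem finrank_fixedIn_top_le {τ : Equiv.Perm (SignedSet n)} (hτ : τ ∈ typeB n) :
    finrank ℝ (fixedIn (permRep _) ⊤ τ)
      ≤ finrank ℝ (fixedIn (permRep _) (evenFun n) τ) + finrank ℝ (oddFixed τ) := by
  refine le_trans (Submodule.finrank_mono ?_) (Submodule.finrank_add_le_finrank_add_finrank _ _)
  rintro f ⟨-, hf⟩
  rw [permRep_eq_iff] at hf
  have hf' (x : SignedSet n) : f (-τ x) = f (-x) := by rw [← hτ x, hf]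
  refine Submodule.mem_sup.2 ⟨WithLp.toLp 2 fun x => (f x + f (-x)) / 2, ⟨?_, ?_⟩,
    WithLp.toLp 2 fun x => (f x - f (-x)) / 2, ⟨?_, ?_⟩, ?_⟩
  · intro x
    simp only [neg_neg, add_comm]
  · rw [permRep_eq_iff]
    intro x
    simp only [hf, hf']
  · intro x
    simp only [neg_neg]
    ring
  · rw [permRep_eq_iff]
    intro x
    simp only [hf, hf']
  · ext x
    simp only [PiLp.add_apply]
    ring

/-- A non-crossing permutation lies below `γ` for the codimension order on odd functions. -/
theorem finrank_oddFun_le_of_mem_Snc {γ τ : Equiv.Perm (SignedSet n)} (hγ : γ ∈ typeB n)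
    (hfix : oddFixed γ = ⊥) (hτ : τ ∈ typeB n) (h : τ ∈ Snc γ) :
    finrank ℝ (oddFun n) ≤ finrank ℝ (oddFixed τ) + finrank ℝ (oddFixed (τ⁻¹ * γ)) := by
  have hτγ := (typeB n).mul_mem ((typeB n).inv_mem hτ) hγ
  have h1 : _ + _ + _ = _ := h
  rw [numOrbits_zpowers, numOrbits_zpowers, numOrbits_zpowers] at h1
  have h2 := finrank_fixedIn_top_le hτ
  have h3 := finrank_fixedIn_top_le hτγ
  have h4 := finrank_fixedIn_top_le hγ
  rw [hfix, finrank_bot] at h4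
  have h5 := finrank_evenFun_add_finrank_oddFun_le (n := n)
  -- An even function fixed by `τ` and `τ⁻¹ * γ` is constant on the orbits of the group generated by
  -- `τ` and `γ`, so the even part accounts for at most dim(even) + 2 #(τ, γ).
  have h6 := finrank_fixedIn_genus_le (ρ := permRep _) (W := evenFun n) τ (τ⁻¹ * γ)
    (permRep_mem_evenFun hτγ)
  rw [mul_inv_cancel_left] at h6
  have h7 : fixedIn (permRep _) (evenFun n) τ ⊓ fixedIn (permRep _) (evenFun n) (τ⁻¹ * γ)
      ≤ fixedIn (permRep _) (evenFun n) τ ⊓ fixedIn (permRep _) (evenFun n) γ := by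
    refine le_inf inf_le_left ?_
    have := fixedIn_inf_le_mul (ρ := permRep _) (W := evenFun n) τ (τ⁻¹ * γ)
    rwa [mul_inv_cancel_left] at this
  have h8 := Submodule.finrank_mono h7
  have h9 := finrank_fixedIn_inf_le (evenFun n) τ γ
  omega

end SignedFunctions

/-! ### Reflections and reflection length in D_n -/

variable {n : ℕ}

/-- The odd function which is `1` at `x`, `-1` at `-x` and `0` elsewhere. -/
noncomputable def signedDelta (x : SignedSet n) : EuclideanSpace ℝ (SignedSet n) :=
  WithLp.toLp 2 fun z => (if z = x then 1 else 0) - (if z = -x then 1 else 0)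

theorem signedDelta_apply (x z : SignedSet n) :
    signedDelta x z = (if z = x then 1 else 0) - (if z = -x then 1 else 0) := rfl

theorem signedDelta_neg (x : SignedSet n) : signedDelta (-x) = -signedDelta x := by
  ext z
  simp only [PiLp.neg_apply, signedDelta_apply, neg_neg, neg_sub]

theorem signedDelta_mem_oddFun (x : SignedSet n) : signedDelta x ∈ oddFun n := by
  intro z
  simp only [signedDelta_apply, neg_eq_iff_eq_neg, neg_neg, neg_sub]

theorem signedDelta_apply_self (x : SignedSet n) : signedDelta x x = 1 := by
  rw [signedDelta_apply, if_pos rfl, if_neg (SignedSet.neg_ne_self x).symm, sub_zero]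

theorem signedDelta_injective : Function.Injective (signedDelta (n := n)) := by
  intro a b h
  by_contra hab
  have h1 : signedDelta a a = signedDelta b a := by rw [h]
  rw [signedDelta_apply_self, signedDelta_apply, if_neg hab] at h1
  split_ifs at h1 <;> norm_num at h1

theorem permRep_signedDelta {τ : Equiv.Perm (SignedSet n)} (hτ : τ ∈ typeB n) (x : SignedSet n) :
    permRep _ τ (signedDelta x) = signedDelta (τ x) := by
  ext z
  simp only [permRep_apply, signedDelta_apply, Equiv.Perm.inv_eq_iff_eq, hτ x]

theorem signedDelta_mem_oddFixed {τ : Equiv.Perm (SignedSet n)} (hτ : τ ∈ typeB n)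
    {x : SignedSet n} : signedDelta x ∈ oddFixed τ ↔ τ x = x := by
  rw [mem_fixedIn, permRep_signedDelta hτ, signedDelta_injective.eq_iff]
  exact and_iff_right (signedDelta_mem_oddFun x)

theorem oddFixed_one : oddFixed (1 : Equiv.Perm (SignedSet n)) = oddFun n :=
  le_antisymm (fixedIn_le _) fun _ hf => ⟨hf, by rw [map_one]; rfl⟩

theorem finrank_oddFixed_add_le (u v : Equiv.Perm (SignedSet n)) :
    finrank ℝ (oddFixed u) + finrank ℝ (oddFixed v)
      ≤ finrank ℝ (oddFun n) + finrank ℝ (oddFixed (u * v)) :=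
  finrank_fixedIn_add_le u v

/-- The reflection `(a,b)(-a,-b)`. -/
def signedSwap (a b : SignedSet n) : Equiv.Perm (SignedSet n) :=
  Equiv.swap a b * Equiv.swap (-a) (-b)

theorem signedSwap_comm (a b : SignedSet n) : signedSwap a b = signedSwap b a := by
  rw [signedSwap, signedSwap, Equiv.swap_comm a, Equiv.swap_comm (-a)]

theorem swap_neg_apply (a b x : SignedSet n) :
    Equiv.swap (-a) (-b) (-x) = -Equiv.swap a b x := by
  simp only [Equiv.swap_apply_def, neg_inj]
  split_ifs <;> rfl

theorem commute_swap_swap_neg {a b : SignedSet n} (h : b ≠ -a) :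
    Equiv.swap a b * Equiv.swap (-a) (-b) = Equiv.swap (-a) (-b) * Equiv.swap a b := by
  by_cases hab : a = b
  · subst hab
    simp
  refine (Equiv.Perm.Disjoint.commute ?_).eq
  apply Equiv.Perm.disjoint_swap_swap
  have h1 := SignedSet.neg_ne_self a
  have h2 := SignedSet.neg_ne_self b
  have h3 : a ≠ -b := fun h' => h (by rw [h', neg_neg])
  have h4 : -a ≠ -b := fun h' => hab (neg_injective h')
  simp [hab, h1.symm, h2.symm, h, h3, h4]

theorem signedSwap_mem_typeB {a b : SignedSet n} (h : b ≠ -a) : signedSwap a b ∈ typeB n := by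
  intro x
  have h1 := swap_neg_apply (-a) (-b) (Equiv.swap a b x)
  rw [neg_neg, neg_neg] at h1
  rw [signedSwap, Equiv.Perm.mul_apply, swap_neg_apply, h1, commute_swap_swap_neg h,
    Equiv.Perm.mul_apply]

theorem signedSwap_mem_typeD {a b : SignedSet n} (hab : a ≠ b) (h : b ≠ -a) :
    signedSwap a b ∈ typeD n := by
  refine ⟨signedSwap_mem_typeB h, ?_⟩
  change _ ∈ alternatingGroup _
  rw [Equiv.Perm.mem_alternatingGroup, signedSwap, Equiv.Perm.sign_mul,
    Equiv.Perm.sign_swap hab, Equiv.Perm.sign_swap (fun h' => hab (neg_injective h'))]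
  rfl

theorem signedSwap_mul_self {a b : SignedSet n} (h : b ≠ -a) :
    signedSwap a b * signedSwap a b = 1 := by
  nth_rewrite 2 [signedSwap]
  rw [commute_swap_swap_neg h, signedSwap, mul_assoc, ← mul_assoc (Equiv.swap (-a) (-b)),
    Equiv.swap_mul_self, one_mul, Equiv.swap_mul_self]

theorem signedSwap_apply_right {a b : SignedSet n} (h : b ≠ -a) : signedSwap a b b = a := by
  rw [signedSwap, Equiv.Perm.mul_apply,
    Equiv.swap_apply_of_ne_of_ne h (SignedSet.neg_ne_self b).symm, Equiv.swap_apply_right]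

theorem signedSwap_neg {a b : SignedSet n} (h : b ≠ -a) :
    signedSwap (-a) (-b) = signedSwap a b := by
  rw [signedSwap, signedSwap, neg_neg, neg_neg, commute_swap_swap_neg h]

theorem signedSwap_mem_generatorsD {a b : SignedSet n} (hab : a ≠ b) (h : b ≠ -a) :
    signedSwap a b ∈ generatorsD n := by
  have pos {a b : SignedSet n} (hab : a ≠ b) (h : b ≠ -a) (ha : 0 < (a : ℤ)) :
      signedSwap a b ∈ generatorsD n := by
    have h1 : (a : ℤ) ≠ b := fun h' => hab (Subtype.ext h')
    have h2 : (b : ℤ) ≠ -(a : ℤ) := fun h' => h (Subtype.ext h')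
    have hb := b.2
    simp only [Finset.mem_erase] at hb
    rcases lt_or_gt_of_ne hb.1 with hb0 | hb0
    · have hnb : ((-b : SignedSet n) : ℤ) = -(b : ℤ) := rfl
      rcases lt_or_gt_of_ne h2 with h3 | h3
      · refine ⟨a, -b, ha, by omega, Or.inr ?_⟩
        rw [neg_neg]
        rfl
      · refine ⟨-b, a, by omega, by omega, Or.inr ?_⟩
        rw [neg_neg, signedSwap, commute_swap_swap_neg h, Equiv.swap_comm a,
          Equiv.swap_comm (-a)]
    · rcases lt_or_gt_of_ne h1 with h3 | h3
      · exact ⟨a, b, ha, h3, Or.inl rfl⟩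
      · refine ⟨b, a, hb0, h3, Or.inl ?_⟩
        exact signedSwap_comm a b
  have ha := a.2
  simp only [Finset.mem_erase] at ha
  rcases lt_or_gt_of_ne ha.1 with ha0 | ha0
  · rw [← signedSwap_neg h]
    refine pos (fun h' => hab (neg_injective h')) (fun h' => h (neg_injective h')) ?_
    change 0 < -(a : ℤ)
    omega
  · exact pos hab h ha0

theorem exists_signedSwap_of_mem_generatorsD {g : Equiv.Perm (SignedSet n)}
    (hg : g ∈ generatorsD n) : ∃ a b, g = signedSwap a b := by
  obtain ⟨i, j, -, -, rfl | rfl⟩ := hg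
  · exact ⟨i, j, rfl⟩
  · exact ⟨i, -j, by rw [signedSwap, neg_neg]⟩

theorem apply_swap_of_eq {X Y : Type*} [DecidableEq X] {f : X → Y} {a b : X} (h : f a = f b)
    (x : X) : f (Equiv.swap a b x) = f x := by
  rw [Equiv.swap_apply_def]
  split_ifs with h1 h2
  · rw [h1, h]
  · rw [h2, h]
  · rfl

theorem mem_oddFixed_signedSwap {a b : SignedSet n} {f : EuclideanSpace ℝ (SignedSet n)}
    (hf : f ∈ oddFun n) (h : f a = f b) : f ∈ oddFixed (signedSwap a b) := by
  refine mem_oddFixed.2 ⟨hf, fun x => ?_⟩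
  have h' : f (-a) = f (-b) := by rw [hf, hf, h]
  rw [signedSwap, Equiv.Perm.mul_apply, apply_swap_of_eq h, apply_swap_of_eq h']

/-- The single linear condition `f a = f b` suffices for `f` to be fixed. -/
theorem finrank_oddFun_le_signedSwap (a b : SignedSet n) :
    finrank ℝ (oddFun n) ≤ 1 + finrank ℝ (oddFixed (signedSwap a b)) := by
  let φ : oddFun n →ₗ[ℝ] ℝ :=
    { toFun := fun f => (f : EuclideanSpace ℝ (SignedSet n)) a
        - (f : EuclideanSpace ℝ (SignedSet n)) b
      map_add' := fun f g => by
        simp only [Submodule.coe_add, PiLp.add_apply]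
        ring
      map_smul' := fun c f => by
        simp only [Submodule.coe_smul, PiLp.smul_apply, smul_eq_mul, RingHom.id_apply]
        ring }
  have h1 := φ.finrank_range_add_finrank_ker
  have h2 := Submodule.finrank_le (LinearMap.range φ)
  rw [finrank_self] at h2
  have h3 : finrank ℝ (LinearMap.ker φ) ≤ finrank ℝ (oddFixed (signedSwap a b)) := by
    rw [LinearEquiv.finrank_eq (Submodule.equivMapOfInjective _ (oddFun n).subtype_injective _)]
    refine Submodule.finrank_mono ?_
    rintro _ ⟨f, hf, rfl⟩
    exact mem_oddFixed_signedSwap f.2 (sub_eq_zero.1 hf)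
  omega

theorem finrank_oddFun_le_length_add {l : List (Equiv.Perm (SignedSet n))}
    (hl : ∀ g ∈ l, g ∈ generatorsD n) :
    finrank ℝ (oddFun n) ≤ l.length + finrank ℝ (oddFixed l.prod) := by
  induction l with
  | nil => rw [List.prod_nil, oddFixed_one]; omega
  | cons g l ih =>
    have h1 := ih fun g' hg' => hl g' (List.mem_cons_of_mem _ hg')
    obtain ⟨a, b, rfl⟩ := exists_signedSwap_of_mem_generatorsD (hl g List.mem_cons_self)
    have h2 := finrank_oddFun_le_signedSwap a b
    have h3 := finrank_oddFixed_add_le (signedSwap a b) l.prod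
    rw [List.prod_cons, List.length_cons]
    omega

/-- Every nontrivial element of `D_n` can be multiplied by a reflection so as to fix more
odd functions. -/
theorem exists_signedSwap_oddFixed_lt {τ : Equiv.Perm (SignedSet n)} (hτ : τ ∈ typeD n)
    (hne : τ ≠ 1) :
    ∃ a b : SignedSet n, a ≠ b ∧ b ≠ -a ∧ oddFixed τ < oddFixed (signedSwap a b * τ) := by
  have hle {a b : SignedSet n} (h : ∀ f ∈ oddFixed τ, f a = f b) :
      oddFixed τ ≤ oddFixed (signedSwap a b * τ) := fun f hf =>
    fixedIn_inf_le_mul _ _ ⟨mem_oddFixed_signedSwap hf.1 (h f hf), hf⟩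
  by_cases hx : ∃ x, τ x ≠ x ∧ τ x ≠ -x
  · obtain ⟨x, h1, h2⟩ := hx
    refine ⟨x, τ x, h1.symm, h2, lt_of_le_of_ne (hle fun f hf => ((mem_oddFixed.1 hf).2 x).symm) ?_⟩
    intro heq
    have h3 : signedDelta x ∈ oddFixed (signedSwap x (τ x) * τ) := by
      rw [signedDelta_mem_oddFixed ((typeB n).mul_mem (signedSwap_mem_typeB h2) hτ.1),
        Equiv.Perm.mul_apply, signedSwap_apply_right h2]
    rw [← heq, signedDelta_mem_oddFixed hτ.1] at h3
    exact h1 h3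
  -- Now `τ` only changes signs. It negates at least two pairs, since a single transposition `(x,
  -- -x)` is odd; this is where D_n differs from B_n.
  · have hx' (x : SignedSet n) (h : τ x ≠ x) : τ x = -x := by
      by_contra h'
      exact hx ⟨x, h, h'⟩
    obtain ⟨x, h1⟩ : ∃ x, τ x ≠ x := by
      by_contra! h
      exact hne (Equiv.ext h)
    obtain ⟨y, h2, hxy, hyx⟩ : ∃ y, τ y ≠ y ∧ x ≠ y ∧ y ≠ -x := by
      by_contra! h
      have hsw : τ = Equiv.swap x (-x) := by
        ext1 z
        rw [Equiv.swap_apply_def]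
        split_ifs with h3 h4
        · rw [h3, hx' x h1]
        · rw [h4, hτ.1 x, hx' x h1]
          exact neg_neg x
        · by_contra h5
          exact h4 (h z h5 (Ne.symm h3))
      have h3 : τ ∈ alternatingGroup _ := hτ.2
      rw [Equiv.Perm.mem_alternatingGroup, hsw,
        Equiv.Perm.sign_swap (SignedSet.neg_ne_self x).symm] at h3
      exact absurd h3 (by decide)
    have hzero (z : SignedSet n) (hz : τ z ≠ z) (f) (hf : f ∈ oddFixed τ) : f z = 0 := by
      have h3 := (mem_oddFixed.1 hf).2 z
      rw [hx' z hz, (mem_oddFixed.1 hf).1] at h3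
      linarith
    refine ⟨x, y, hxy, hyx, lt_of_le_of_ne
      (hle fun f hf => by rw [hzero x h1 f hf, hzero y h2 f hf]) ?_⟩
    intro heq
    have ht := signedSwap_mem_typeB hyx
    have htx : signedSwap x y x = y := by
      rw [signedSwap_comm]
      exact signedSwap_apply_right fun h => hyx (by rw [h, neg_neg])
    -- The product sends `x` to `-y` and `y` to `-x`, so it fixes this difference, whereas functions
    -- fixed by `τ` vanish at `x`.
    have h3 : signedDelta x - signedDelta y ∈ oddFixed (signedSwap x y * τ) := by
      refine ⟨(oddFun n).sub_mem (signedDelta_mem_oddFun x) (signedDelta_mem_oddFun y), ?_⟩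
      have htτ := (typeB n).mul_mem ht hτ.1
      rw [map_sub, permRep_signedDelta htτ, permRep_signedDelta htτ, Equiv.Perm.mul_apply,
        Equiv.Perm.mul_apply, hx' x h1, hx' y h2, ht x, ht y, htx, signedSwap_apply_right hyx,
        signedDelta_neg, signedDelta_neg]
      abel
    rw [← heq] at h3
    have h4 := hzero x h1 _ h3
    have h5 : x ≠ -y := fun h => hyx (by rw [h, neg_neg])
    rw [PiLp.sub_apply, signedDelta_apply_self, signedDelta_apply, if_neg hxy, if_neg h5] at h4
    norm_num at h4

/-- Induction on a bound `k` for the codimension of the fixed space, which a suitable reflection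
strictly decreases unless `τ = 1`. -/
theorem exists_list_generatorsD (k : ℕ) {τ : Equiv.Perm (SignedSet n)} (hτ : τ ∈ typeD n)
    (hk : finrank ℝ (oddFun n) ≤ k + finrank ℝ (oddFixed τ)) :
    ∃ l : List (Equiv.Perm (SignedSet n)), (∀ g ∈ l, g ∈ generatorsD n) ∧ l.prod = τ ∧
      l.length + finrank ℝ (oddFixed τ) ≤ finrank ℝ (oddFun n) := by
  induction k generalizing τ with
  | zero =>
    by_cases h1 : τ = 1
    · exact ⟨[], by simp, h1.symm, by
        rw [List.length_nil, zero_add]; exact Submodule.finrank_mono (fixedIn_le _)⟩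
    · obtain ⟨a, b, hab, h, hlt⟩ := exists_signedSwap_oddFixed_lt hτ h1
      have h2 := Submodule.finrank_lt_finrank_of_lt hlt
      have h3 : finrank ℝ (oddFixed (signedSwap a b * τ)) ≤ _ :=
        Submodule.finrank_mono (fixedIn_le _)
      omega
  | succ k ih =>
    by_cases h1 : τ = 1
    · exact ⟨[], by simp, h1.symm, by
        rw [List.length_nil, zero_add]; exact Submodule.finrank_mono (fixedIn_le _)⟩
    · obtain ⟨a, b, hab, h, hlt⟩ := exists_signedSwap_oddFixed_lt hτ h1
      have h2 := Submodule.finrank_lt_finrank_of_lt hlt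
      obtain ⟨l, hl, hprod, hlen⟩ :=
        ih ((typeD n).mul_mem (signedSwap_mem_typeD hab h) hτ) (by omega)
      refine ⟨signedSwap a b :: l, ?_, ?_, ?_⟩
      · intro g hg
        rcases List.mem_cons.1 hg with rfl | hg
        · exact signedSwap_mem_generatorsD hab h
        · exact hl g hg
      · rw [List.prod_cons, hprod, ← mul_assoc, signedSwap_mul_self h, one_mul]
      · rw [List.length_cons]
        omega

/-- The reflection length in `D_n` is the codimension of the space of fixed odd functions. -/
theorem lengthD_add_finrank_oddFixed {τ : Equiv.Perm (SignedSet n)} (hτ : τ ∈ typeD n) :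
    lengthD τ + finrank ℝ (oddFixed τ) = finrank ℝ (oddFun n) := by
  obtain ⟨l, hl, hprod, hlen⟩ := exists_list_generatorsD _ hτ (Nat.le_add_right _ _)
  have h1 : lengthD τ ≤ l.length := Nat.sInf_le ⟨l, rfl, hl, hprod⟩
  obtain ⟨l', hl', hgen', hprod'⟩ : lengthD τ ∈ {k | ∃ l : List (Equiv.Perm (SignedSet n)),
      l.length = k ∧ (∀ g ∈ l, g ∈ generatorsD n) ∧ l.prod = τ} :=
    Nat.sInf_mem ⟨l.length, l, rfl, hl, hprod⟩
  have h2 := finrank_oddFun_le_length_add hgen'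
  rw [hprod', hl'] at h2
  omega

/-! ### Blocks as level sets of fixed odd functions -/

theorem InZeroBlock.of_sameCycle_neg {τ : Equiv.Perm (SignedSet n)} (hτ : τ ∈ typeB n)
    {x : SignedSet n} (h : τ.SameCycle x (-x)) : InZeroBlock τ x := by
  have hneg {y z : SignedSet n} (h : τ.SameCycle y z) : τ.SameCycle (-y) (-z) := by
    obtain ⟨i, rfl⟩ := h
    exact ⟨i, (typeB n).zpow_mem hτ i y⟩
  intro y
  refine ⟨fun hy => h.trans (hneg hy), fun hy => ?_⟩
  have h1 := hneg hy
  rw [neg_neg] at h1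
  exact h.trans h1

theorem apply_eq_of_sameCycle_of_mem_oddFixed {τ : Equiv.Perm (SignedSet n)}
    {f : EuclideanSpace ℝ (SignedSet n)} (hf : f ∈ oddFixed τ) {x y : SignedSet n}
    (h : τ.SameCycle x y) : f x = f y := by
  obtain ⟨i, rfl⟩ := h
  have hS : ∀ g ∈ ({τ} : Set (Equiv.Perm (SignedSet n))), permRep _ g f = f := by
    rintro _ rfl
    exact hf.2
  exact (apply_eq_of_mem_closure hS
    (Subgroup.zpow_mem _ (Subgroup.subset_closure (Set.mem_singleton τ)) i) x).symm

/-- The blocks of `omegaTilde τ` are the level sets of the odd functions fixed by `τ`. -/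
theorem omegaTilde_iff {τ : Equiv.Perm (SignedSet n)} (hτ : τ ∈ typeB n) {x y : SignedSet n} :
    omegaTilde τ x y ↔ ∀ f ∈ oddFixed τ, f x = f y := by
  constructor
  · rintro (h | ⟨hx, hy⟩) f hf
    · exact apply_eq_of_sameCycle_of_mem_oddFixed hf h
    · have hzero {z : SignedSet n} (hz : InZeroBlock τ z) : f z = 0 := by
        have h1 := apply_eq_of_sameCycle_of_mem_oddFixed hf ((hz z).1 (Equiv.Perm.SameCycle.refl τ z))
        rw [(mem_oddFixed.1 hf).1] at h1
        linarith
      rw [hzero hx, hzero hy]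
  · classical
    have key {x y : SignedSet n} (hx : ¬ InZeroBlock τ x)
        (h : ∀ f ∈ oddFixed τ, f x = f y) : τ.SameCycle x y := by
      -- The indicator of the orbit of `x` minus that of the orbit of `-x`. These orbits are
      -- distinct, so `f` is 1 at `x` and at most 0 off its orbit.
      let f : EuclideanSpace ℝ (SignedSet n) := WithLp.toLp 2 fun z =>
        (if τ.SameCycle x z then 1 else 0) - (if τ.SameCycle x (-z) then 1 else 0)
      have hf : f ∈ oddFixed τ := by
        refine mem_oddFixed.2 ⟨fun z => ?_, fun z => ?_⟩
        · simp only [f, neg_neg]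
          ring
        · simp only [f, ← show τ (-z) = -τ z from hτ z, Equiv.Perm.sameCycle_apply_right]
      have h1 := h f hf
      have h2 : ¬ τ.SameCycle x (-x) := fun h => hx (.of_sameCycle_neg hτ h)
      by_contra hxy
      simp only [f, if_neg h2, if_neg hxy, if_pos (Equiv.Perm.SameCycle.refl τ x)] at h1
      split_ifs at h1 <;> norm_num at h1
    intro h
    by_cases hx : InZeroBlock τ x
    · by_cases hy : InZeroBlock τ y
      · exact Or.inr ⟨hx, hy⟩
      · exact Or.inl (key hy fun f hf => (h f hf).symm).symm
    · exact Or.inl (key hx h)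

theorem omegaTilde_le_iff {σ τ : Equiv.Perm (SignedSet n)} (hσ : σ ∈ typeB n)
    (hτ : τ ∈ typeB n) : omegaTilde σ ≤ omegaTilde τ ↔ oddFixed τ ≤ oddFixed σ := by
  constructor
  · intro h f hf
    refine mem_oddFixed.2 ⟨hf.1, fun x => ?_⟩
    have h1 : omegaTilde σ (σ x) x :=
      Or.inl (Equiv.Perm.sameCycle_apply_left.2 (Equiv.Perm.SameCycle.refl σ x))
    exact (omegaTilde_iff hτ).1 (h h1) f hf
  · intro h x y hxy
    exact (omegaTilde_iff hτ).2 fun f hf => (omegaTilde_iff hσ).1 hxy f (h hf)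

/-! ### The permutation γ fixes no nonzero odd function -/

theorem gamma_mem_typeB (p q : ℕ) : gamma p q ∈ typeB (p + q) := by
  intro x
  apply Subtype.ext
  have hx := x.2
  simp only [Finset.mem_erase, Finset.mem_Icc] at hx
  change gammaFun p q (-(x : ℤ)) = -gammaFun p q x
  unfold gammaFun
  omega

theorem oddFixed_gamma (p q : ℕ) : oddFixed (gamma p q) = ⊥ := by
  rw [eq_bot_iff]
  intro f hf
  obtain ⟨hodd, hfix⟩ := mem_oddFixed.1 hf
  classical
  -- Extension by zero, so that the cycles can be followed by integer arithmetic without membership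
  -- proofs.
  let F : ℤ → ℝ := fun k =>
    if h : k ∈ (Finset.Icc (-((p + q : ℕ) : ℤ)) ((p + q : ℕ) : ℤ)).erase 0 then f ⟨k, h⟩ else 0
  have hF (x : SignedSet (p + q)) : F x = f x := dif_pos x.2
  have hFneg (k : ℤ) (h0 : 0 < k) (h1 : k ≤ p + q) : F (-k) = -F k := by
    have hk : k ∈ (Finset.Icc (-((p + q : ℕ) : ℤ)) ((p + q : ℕ) : ℤ)).erase 0 := by
      simp only [Finset.mem_erase, Finset.mem_Icc]
      omega
    have := hodd ⟨k, hk⟩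
    rwa [← hF, ← hF] at this
  have hFγ (k l : ℤ) (h0 : 0 < k) (h1 : k ≤ p + q) (hl : gammaFun p q k = l) : F l = F k := by
    have hk : k ∈ (Finset.Icc (-((p + q : ℕ) : ℤ)) ((p + q : ℕ) : ℤ)).erase 0 := by
      simp only [Finset.mem_erase, Finset.mem_Icc]
      omega
    have := hfix ⟨k, hk⟩
    rw [← hF, ← hF] at this
    rw [← hl]
    exact this
  have first (k : ℕ) (hk : k < p) : F (k + 1) = F 1 := by
    induction k with
    | zero => simp
    | succ k ih =>
      rw [← ih (by omega)]
      refine hFγ _ _ (by omega) (by omega) ?_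
      unfold gammaFun
      push_cast
      omega
  have second (k : ℕ) (hk : k < q) : F (p + k + 1) = F (p + 1) := by
    induction k with
    | zero => simp
    | succ k ih =>
      rw [← ih (by omega)]
      refine hFγ _ _ (by omega) (by omega) ?_
      unfold gammaFun
      push_cast
      omega
  have first_zero (hp : 0 < p) : F 1 = 0 := by
    -- The cycle passes from `p` to `-1`, so `F 1 = F (-1) = -F 1`.
    have h1 := hFγ p (-1) (by omega) (by omega) (if_pos rfl)
    have h2 := hFneg 1 (by omega) (by omega)
    have h3 := first (p - 1) (by omega)
    rw [show (((p - 1 : ℕ) : ℤ) + 1) = p by omega] at h3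
    linarith
  have second_zero (hq : 0 < q) : F (p + 1) = 0 := by
    have h1 := hFγ (p + q) (-(p + 1)) (by omega) (by omega) (by unfold gammaFun; omega)
    have h2 := hFneg (p + 1) (by omega) (by omega)
    have h3 := second (q - 1) (by omega)
    rw [show ((p : ℤ) + ((q - 1 : ℕ) : ℤ) + 1) = p + q by omega] at h3
    linarith
  have pos (k : ℤ) (h0 : 0 < k) (h1 : k ≤ p + q) : F k = 0 := by
    by_cases hk : k ≤ p
    · have h2 := first (k - 1).toNat (by omega)
      rw [show (((k - 1).toNat : ℤ) + 1) = k by omega] at h2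
      rw [h2, first_zero (by omega)]
    · have h2 := second (k - p - 1).toNat (by omega)
      rw [show ((p : ℤ) + ((k - p - 1).toNat : ℤ) + 1) = k by omega] at h2
      rw [h2, second_zero (by omega)]
  rw [Submodule.mem_bot]
  ext x
  have hx := x.2
  simp only [Finset.mem_erase, Finset.mem_Icc] at hx
  rw [PiLp.zero_apply, ← hF]
  rcases lt_or_gt_of_ne hx.1 with h | h
  · have h1 := hFneg (-x) (by omega) (by omega)
    rw [neg_neg, pos (-x) (by omega) (by omega), neg_zero] at h1
    exact h1
  · exact pos x h (by omega)

/-! ### Comparison of the two orders -/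

theorem finrank_oddFixed_of_omegaTilde_le {p q : ℕ} (σ τ : SncD p q)
    (h : omegaTilde σ.1 ≤ omegaTilde τ.1) :
    finrank ℝ (oddFun (p + q)) + finrank ℝ (oddFixed τ.1)
      = finrank ℝ (oddFixed σ.1) + finrank ℝ (oddFixed (σ.1⁻¹ * τ.1)) := by
  have hγ := gamma_mem_typeB p q
  have hfix := oddFixed_gamma p q
  have hσ := σ.2.2.1
  have hτ := τ.2.2.1
  have h1 : finrank ℝ (oddFun (p + q)) + finrank ℝ (oddFixed τ.1)
      ≤ finrank ℝ (oddFixed (σ.1⁻¹ * τ.1)) + finrank ℝ (oddFixed σ.1) :=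
    finrank_fixedIn_inv_mul_le (permRep_mem_oddFun hγ) hfix
    (finrank_oddFun_le_of_mem_Snc hγ hfix hσ σ.2.1)
    (finrank_oddFun_le_of_mem_Snc hγ hfix hτ τ.2.1) ((omegaTilde_le_iff hσ hτ).1 h)
  have h2 := finrank_oddFixed_add_le σ.1 (σ.1⁻¹ * τ.1)
  rw [mul_inv_cancel_left] at h2
  omega

theorem omegaTilde_le_iff_le {p q : ℕ} (σ τ : SncD p q) :
    omegaTilde σ.1 ≤ omegaTilde τ.1 ↔ σ ≤ τ := by
  have h1 := lengthD_add_finrank_oddFixed σ.2.2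
  have h2 := lengthD_add_finrank_oddFixed τ.2.2
  have h3 := lengthD_add_finrank_oddFixed
    ((typeD (p + q)).mul_mem ((typeD (p + q)).inv_mem σ.2.2) τ.2.2)
  have hle : σ ≤ τ ↔ lengthD τ.1 = lengthD σ.1 + lengthD (σ.1⁻¹ * τ.1) := Iff.rfl
  rw [hle]
  constructor
  · intro h
    have h4 := finrank_oddFixed_of_omegaTilde_le σ τ h
    omega
  · intro h
    rw [omegaTilde_le_iff σ.2.2.1 τ.2.2.1]
    have h4 : finrank ℝ (oddFun (p + q)) + finrank ℝ (oddFixed τ.1)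
        ≤ finrank ℝ (oddFixed σ.1) + finrank ℝ (oddFixed (σ.1⁻¹ * τ.1)) := by omega
    have h5 := fixedIn_mul_le_of_finrank_eq (ρ := permRep _) (W := oddFun (p + q))
      (u := σ.1) (v := σ.1⁻¹ * τ.1) (by rwa [mul_inv_cancel_left])
    rwa [mul_inv_cancel_left] at h5

theorem omegaTilde_injective (p q : ℕ) :
    Function.Injective fun τ : SncD p q => omegaTilde τ.1 := by
  intro σ τ h
  have h1 : omegaTilde σ.1 = omegaTilde τ.1 := h
  have h2 := finrank_oddFixed_of_omegaTilde_le σ τ h1.le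
  have h3 : oddFixed σ.1 = oddFixed τ.1 :=
    le_antisymm ((omegaTilde_le_iff τ.2.2.1 σ.2.2.1).1 h1.ge)
      ((omegaTilde_le_iff σ.2.2.1 τ.2.2.1).1 h1.le)
  -- Equal fixed spaces leave codimension zero for `σ⁻¹τ`, and the functions `signedDelta x` detect
  -- that it is the identity.
  have h4 : oddFixed (σ.1⁻¹ * τ.1) = oddFun (p + q) :=
    Submodule.eq_of_le_of_finrank_le (fixedIn_le _) (by rw [h3] at h2; omega)
  have hB := (typeB (p + q)).mul_mem ((typeB (p + q)).inv_mem σ.2.2.1) τ.2.2.1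
  apply Subtype.ext
  rw [← inv_mul_eq_one]
  ext1 x
  have h5 := signedDelta_mem_oddFun x
  rw [← h4, signedDelta_mem_oddFixed hB] at h5
  exact h5

end AnnularNC

theorem corollary7p2 (p q : ℕ) (hp : 0 < p) (hq : 0 < q) :
    ∃ e : AnnularNC.SncD p q ≃o AnnularNC.NCD p q,
      ∀ τ : AnnularNC.SncD p q,
        (e τ : Setoid (AnnularNC.SignedSet (p + q))) = AnnularNC.omegaTilde τ.1 := by
  let φ : AnnularNC.SncD p q → AnnularNC.NCD p q :=
    fun τ => ⟨AnnularNC.omegaTilde τ.1, τ.1, τ.2, rfl⟩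
  have hφ : Function.Bijective φ := by
    refine ⟨fun σ τ h => AnnularNC.omegaTilde_injective p q (congrArg Subtype.val h), ?_⟩
    rintro ⟨_, τ, hτ, rfl⟩
    exact ⟨⟨τ, hτ⟩, rfl⟩
  exact ⟨⟨Equiv.ofBijective φ hφ, AnnularNC.omegaTilde_le_iff_le _ _⟩, fun _ => rfl⟩
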